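/- Let $\mathbb T=\mathbb R/2\pi\mathbb Z$ and let $(c_k)_{k\in\mathbb Z}$ be a sequence of complex numbers. Suppose that 1. $\sum_{k\in\mathbb Z} c_k e^{ikt}$ is a Fourier–Stieltjes series, that is, there is a (finite) complex Borel measure $\mu$ on $\mathbb T$ with $c_k=\frac1{2\pi}\int_{\mathbb T}e^{-ikt}\,d\mu(t)$ for all $k\in\mathbb Z$; 2. $(c_k)$ is of bounded variation, that is, $\sum_{k=-\infty}^{\infty}|c_k-c_{k+1}|<\infty$; 3. $\lim_{k\to\infty}(c_k-c_{-k})=0$. Then the limit $L=\lim_{|k|\to\infty}c_k$ exists, and $\sum_{k\in\mathbb Z}(c_k-L)e^{ikt}$ is a Fourier series, that is, there is an integrable function $f:\mathbb T\to\mathbb C$ with $c_k-L=\frac1{2\pi}\int_{\mathbb T}f(t)e^{-ikt}\,dt$ for all $k\in\mathbb Z$. -/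

import Mathlib

open MeasureTheory Filter Topology

namespace TrigSeries

/-- The period `2π` is positive (needed for Haar measure on `AddCircle (2 * π)`). -/
instance instFactTwoPiPos : Fact (0 < 2 * Real.pi) := ⟨Real.two_pi_pos⟩

/-- The circle `𝕋 = ℝ / 2πℤ`, i.e. `[-π, π)` with endpoints identified, with its Borel sets. -/
abbrev Circle2Pi : Type := AddCircle (2 * Real.pi)

/-- The `k`-th Fourier–Stieltjes coefficient `(1 / 2π) ∫_𝕋 e^{-ikt} dμ(t)` of a complex Borel
measure `μ` on `𝕋`. Here `fourier (-k)` is the character `t ↦ e^{-ikt}`. -/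
noncomputable def fourierStieltjesCoeff (μ : ComplexMeasure Circle2Pi) (k : ℤ) : ℂ :=
  1 / (2 * (Real.pi : ℂ)) *
    μ.integral (fun t : Circle2Pi => (fourier (-k) t : ℂ)) (ContinuousLinearMap.mul ℝ ℂ)

/-- `∑ c_k e^{ikt}` is the Fourier–Stieltjes series of some complex Borel measure on `𝕋`. -/
def IsFourierStieltjesSeries (c : ℤ → ℂ) : Prop :=
  ∃ μ : ComplexMeasure Circle2Pi, ∀ k : ℤ, c k = fourierStieltjesCoeff μ k

/-- `∑ c_k e^{ikt}` is the Fourier series of some integrable `f : 𝕋 → ℂ`, that is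
`c_k = (1 / 2π) ∫_𝕋 f(t) e^{-ikt} dt` for all `k`. The measure `AddCircle.haarAddCircle` is
`dt / 2π`, and `fourierCoeff f k` is the integral of `e^{-ikt} f(t)` against it. -/
def IsFourierSeries (c : ℤ → ℂ) : Prop :=
  ∃ f : Circle2Pi → ℂ, Integrable f AddCircle.haarAddCircle ∧ ∀ k : ℤ, c k = fourierCoeff f k

/-- The class `bv` of two-sided sequences: `∑_{k ∈ ℤ} |c_k - c_{k+1}| < ∞`. -/
def IsBV (c : ℤ → ℂ) : Prop :=
  Summable fun k : ℤ => ‖c k - c (k + 1)‖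

end TrigSeries

/-!
Multiplying a complex measure `μ` by `1 - e^{-it}` replaces its Fourier coefficients by their
successive differences. When these are absolutely summable they are the coefficients of a continuous
function `g`, so `(1 - e^{-it}) dμ = g dt` by uniqueness of Fourier coefficients, an equality of
densities with respect to `|μ| + dt`. As `1 - e^{-it}` vanishes only at `0`, away from `0` the
measure `μ` has the density `g / (1 - e^{-it})`, which is integrable because `|μ|` is finite. What
is left is the point mass of `μ` at `0`, whose coefficients are constant, and this constant is the
limit by the Riemann–Lebesgue lemma.
-/

open AddCircle
open scoped BoundedContinuousFunction FourierTransform NNReal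

namespace TrigSeries

section Uniqueness

variable {X E : Type*} [TopologicalSpace X] [MeasurableSpace X] [BorelSpace X]
  [HasOuterApproxClosed X] [NormedAddCommGroup E] [NormedSpace ℝ E] [CompleteSpace E]
  {ν : Measure X} {F : X → E}

theorem ae_eq_zero_of_forall_integral_smul_eq_zero (hF : Integrable F ν)
    (h : ∀ φ : X →ᵇ ℝ≥0, ∫ x, φ x • F x ∂ν = 0) : F =ᵐ[ν] 0 := by
  refine ae_eq_zero_of_forall_setIntegral_isClosed_eq_zero hF fun s hs => ?_
  have hlim : Tendsto (fun n => ∫ x, hs.apprSeq n x • F x ∂ν) atTop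
      (𝓝 (∫ x, s.indicator F x ∂ν)) := by
    refine tendsto_integral_of_dominated_convergence (‖F ·‖)
      (fun n => (hs.apprSeq n).continuous.aestronglyMeasurable.smul hF.aestronglyMeasurable)
      hF.norm (fun n => Eventually.of_forall fun x => ?_) (Eventually.of_forall fun x => ?_)
    · rw [NNReal.smul_def, norm_smul, NNReal.norm_eq]
      exact mul_le_of_le_one_left (norm_nonneg _)
        (HasOuterApproxClosed.apprSeq_apply_le_one hs n x)
    · convert (tendsto_pi_nhds.1 (HasOuterApproxClosed.tendsto_apprSeq hs) x).smul_const (F x)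
        using 2
      by_cases hx : x ∈ s <;> simp [hx]
  simp only [h] at hlim
  rw [← integral_indicator hs.measurableSet]
  exact tendsto_nhds_unique hlim tendsto_const_nhds

end Uniqueness

section IntegralSMul

variable {X E 𝕜 : Type*} [TopologicalSpace X] [CompactSpace X] [MeasurableSpace X]
  [NormedAddCommGroup E] [RCLike 𝕜] [NormedSpace 𝕜 E]
  {ν : Measure X} {F : X → E}

theorem integrable_continuousMap_smul [BorelSpace X] (hF : Integrable F ν) (φ : C(X, 𝕜)) :
    Integrable (fun x => φ x • F x) ν :=
  hF.bdd_smul ‖φ‖ φ.continuous.aestronglyMeasurable (Eventually.of_forall φ.norm_coe_le_norm)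

variable [NormedSpace ℝ E]

theorem norm_integral_continuousMap_smul_le (hF : Integrable F ν) (φ : C(X, 𝕜)) :
    ‖∫ x, φ x • F x ∂ν‖ ≤ (∫ x, ‖F x‖ ∂ν) * ‖φ‖ := by
  rw [mul_comm, ← integral_const_mul]
  refine norm_integral_le_of_norm_le (hF.norm.const_mul _) (Eventually.of_forall fun x => ?_)
  rw [norm_smul]
  gcongr
  exact φ.norm_coe_le_norm x

variable [BorelSpace X] [SMulCommClass ℝ 𝕜 E]

variable (𝕜) in
/-- The functional `φ ↦ ∫ φ F dν` on the continuous functions on a compact space, for an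
integrable `F`. -/
noncomputable def integralSMulCLM (hF : Integrable F ν) : C(X, 𝕜) →L[𝕜] E :=
  LinearMap.mkContinuous
    { toFun := fun φ => ∫ x, φ x • F x ∂ν
      map_add' := fun φ ψ => by
        simp only [ContinuousMap.add_apply, add_smul]
        exact integral_add (integrable_continuousMap_smul hF φ) (integrable_continuousMap_smul hF ψ)
      map_smul' := fun a φ => by
        simp only [ContinuousMap.smul_apply, smul_assoc, RingHom.id_apply]
        exact integral_smul _ _ }
    (∫ x, ‖F x‖ ∂ν) (norm_integral_continuousMap_smul_le hF)

theorem integralSMulCLM_apply (hF : Integrable F ν) (φ : C(X, 𝕜)) :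
    integralSMulCLM 𝕜 hF φ = ∫ x, φ x • F x ∂ν := rfl

end IntegralSMul

section FourierCoefficients

theorem tendsto_intCast_div_cofinite_cocompact {T : ℝ} (hT : T ≠ 0) :
    Tendsto (fun n : ℤ => (n / T : ℝ)) cofinite (cocompact ℝ) := by
  simpa only [div_eq_mul_inv, Function.comp_def] using!
    (Homeomorph.mulRight₀ T⁻¹ (inv_ne_zero hT)).isClosedEmbedding.tendsto_cocompact.comp
      Int.tendsto_coe_cofinite

variable {T : ℝ} [Fact (0 < T)]

theorem ae_eq_zero_of_forall_integral_fourier_smul_eq_zero {E : Type*} [NormedAddCommGroup E]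
    [NormedSpace ℂ E] [CompleteSpace E] {ν : Measure (AddCircle T)} {F : AddCircle T → E}
    (hF : Integrable F ν) (h : ∀ k : ℤ, ∫ t, fourier k t • F t ∂ν = 0) : F =ᵐ[ν] 0 := by
  have hzero : integralSMulCLM ℂ hF = 0 :=
    ContinuousLinearMap.ext_on
      ((Submodule.dense_iff_topologicalClosure_eq_top (R := ℂ)).2 span_fourier_closure_eq_top)
      (Set.forall_mem_range.2 h)
  refine ae_eq_zero_of_forall_integral_smul_eq_zero hF fun φ => ?_
  have happly := DFunLike.congr_fun hzero ⟨fun t => ((φ t : ℝ) : ℂ), by fun_prop⟩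
  simpa [integralSMulCLM_apply, NNReal.smul_def] using happly

theorem fourierCoeff_tsum_smul_fourier {d : ℤ → ℂ} (hd : Summable d) (k : ℤ) :
    fourierCoeff (∑' j, d j • fourier j : C(AddCircle T, ℂ)) k = d k := by
  have hsum : Summable fun j => d j • (fourier j : C(AddCircle T, ℂ)) :=
    Summable.of_norm (by simpa only [norm_smul, fourier_norm, mul_one] using hd.norm)
  have hint : Integrable (fourier (-k)) (haarAddCircle (T := T)) :=
    (map_continuous _).integrable_of_hasCompactSupport (HasCompactSupport.of_compactSpace _)
  have hcoeff (φ : C(AddCircle T, ℂ)) : fourierCoeff φ k = integralSMulCLM ℂ hint φ := by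
    simp only [fourierCoeff, integralSMulCLM_apply, smul_eq_mul, mul_comm]
  have hterm (j : ℤ) : integralSMulCLM ℂ hint (d j • fourier j) = if j = k then d j else 0 := by
    rw [map_smul, ← hcoeff, fourierCoeff_fourier]
    simp [Pi.single_apply, eq_comm]
  rw [hcoeff, ContinuousLinearMap.map_tsum _ hsum, tsum_congr hterm, tsum_ite_eq]

theorem fourierCoeff_eq_smul_fourier_indicator {E : Type*} [NormedAddCommGroup E]
    [NormedSpace ℂ E] (f : AddCircle T → E) (n : ℤ) : fourierCoeff f n =
      (1 / T) • 𝓕 ((Set.Ioc 0 T).indicator fun x : ℝ => f x) (n / T) := by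
  have hT : 0 < T := Fact.out
  rw [fourierCoeff_eq_intervalIntegral f n 0, zero_add, intervalIntegral.integral_of_le hT.le,
    ← integral_indicator measurableSet_Ioc, Real.fourier_eq]
  congr 2 with x
  by_cases hx : x ∈ Set.Ioc 0 T
  · simp only [Set.indicator_of_mem hx, Circle.smul_def, Real.fourierChar_apply,
      fourier_coe_apply, RCLike.inner_apply, Real.ringHom_apply]
    congr 2
    push_cast
    ring
  · simp [hx]

theorem tendsto_fourierCoeff_cofinite {E : Type*} [NormedAddCommGroup E]
    [NormedSpace ℂ E] (f : AddCircle T → E) :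
    Tendsto (fourierCoeff f) cofinite (𝓝 0) := by
  have hT : T ≠ 0 := (Fact.out : 0 < T).ne'
  have hlim := ((Real.zero_at_infty_fourier ((Set.Ioc 0 T).indicator fun x : ℝ => f x)).comp
    (tendsto_intCast_div_cofinite_cocompact hT)).const_smul (1 / T)
  rw [smul_zero] at hlim
  exact hlim.congr fun n => (fourierCoeff_eq_smul_fourier_indicator f n).symm

theorem fourier_eq_one_iff {n : ℤ} {t : AddCircle T} : fourier n t = 1 ↔ n • t = 0 := by
  have hT : T ≠ 0 := (Fact.out : 0 < T).ne'
  rw [fourier_apply, ← Circle.coe_one, Circle.coe_inj, ← toCircle_zero,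
    (injective_toCircle hT).eq_iff]

end FourierCoefficients

section DensityVectorMeasure

variable {X E F G : Type*} {mX : MeasurableSpace X}
  [NormedAddCommGroup E] [NormedSpace ℝ E] [NormedAddCommGroup F]
  {ν : Measure X} {h : X → F} {f : X → E}

theorem integrable_withDensity_enorm_iff (hh : AEStronglyMeasurable h ν) :
    Integrable f (ν.withDensity (‖h ·‖ₑ)) ↔ Integrable (fun x => ‖h x‖ • f x) ν := by
  rw [integrable_withDensity_iff_integrable_smul₀' hh.enorm
    (Eventually.of_forall fun x => enorm_lt_top)]
  simp only [toReal_enorm]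

variable [NormedSpace ℝ F] [NormedAddCommGroup G] [NormedSpace ℝ G]

theorem integrable_apply_of_integrable_norm_smul (B : E →L[ℝ] F →L[ℝ] G)
    (hh : AEStronglyMeasurable h ν) (hf : Integrable (fun x => ‖h x‖ • f x) ν) :
    Integrable (fun x => B (f x) (h x)) ν := by
  have hBfh (x : X) : B (‖h x‖⁻¹ • ‖h x‖ • f x) (h x) = B (f x) (h x) := by
    by_cases hx : h x = 0
    · simp [hx]
    · rw [inv_smul_smul₀ (norm_ne_zero_iff.2 hx)]
  refine (hf.norm.const_mul ‖B‖).mono' ?_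
    (Eventually.of_forall fun x => by
      simpa only [norm_smul, norm_norm, mul_comm ‖h x‖, mul_assoc] using
        B.le_opNorm₂ (f x) (h x))
  simp only [← hBfh]
  exact B.aestronglyMeasurable_comp₂
    (hh.norm.aemeasurable.inv.aestronglyMeasurable.smul hf.aestronglyMeasurable) hh

theorem norm_integral_apply_le (B : E →L[ℝ] F →L[ℝ] G)
    (hh : AEStronglyMeasurable h ν) (hf : Integrable f (ν.withDensity (‖h ·‖ₑ))) :
    ‖∫ x, B (f x) (h x) ∂ν‖ ≤ ‖B‖ * ∫ x, ‖f x‖ ∂ν.withDensity (‖h ·‖ₑ) := by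
  have hfi := (integrable_withDensity_enorm_iff hh).1 hf
  rw [integral_withDensity_eq_integral_toReal_smul₀ hh.enorm
    (Eventually.of_forall fun x => enorm_lt_top), ← integral_const_mul]
  refine norm_integral_le_of_norm_le ?_ (Eventually.of_forall fun x => ?_)
  · simpa only [toReal_enorm, norm_smul, norm_norm] using! hfi.norm.const_mul ‖B‖
  · simpa only [toReal_enorm, smul_eq_mul, mul_comm ‖h x‖, mul_assoc] using
      B.le_opNorm₂ (f x) (h x)

theorem continuous_integral_apply (B : E →L[ℝ] F →L[ℝ] G) (hh : AEStronglyMeasurable h ν) :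
    Continuous fun f : Lp E 1 (ν.withDensity (‖h ·‖ₑ)) => ∫ x, B (f x) (h x) ∂ν := by
  have hint (f : Lp E 1 (ν.withDensity (‖h ·‖ₑ))) : Integrable (fun x => B (f x) (h x)) ν :=
    integrable_apply_of_integrable_norm_smul B hh
      ((integrable_withDensity_enorm_iff hh).1 (L1.integrable_coeFn f))
  refine (LipschitzWith.of_dist_le_mul (K := ‖B‖₊) fun f g => ?_).continuous
  rw [dist_eq_norm, L1.dist_eq_integral_dist, ← integral_sub (hint f) (hint g)]
  simpa only [Pi.sub_apply, map_sub, sub_apply, coe_nnnorm, dist_eq_norm] using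
    norm_integral_apply_le B hh ((L1.integrable_coeFn f).sub (L1.integrable_coeFn g))

theorem integral_withDensityᵥ [CompleteSpace F] [CompleteSpace G] {B : E →L[ℝ] F →L[ℝ] G}
    (hh : Integrable h ν) (hf : (ν.withDensityᵥ h).Integrable f) :
    ∫ᵛ x, f x ∂[B; ν.withDensityᵥ h] = ∫ x, B (f x) (h x) ∂ν := by
  have hvar := Measure.variation_withDensityᵥ hh
  have hint {f : X → E} (hf : Integrable f (ν.withDensityᵥ h).variation) :
      Integrable (fun x => B (f x) (h x)) ν :=
    integrable_apply_of_integrable_norm_smul B hh.1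
      ((integrable_withDensity_enorm_iff hh.1).1 (hvar ▸ hf))
  apply Integrable.induction
    (P := fun f => ∫ᵛ x, f x ∂[B; ν.withDensityᵥ h] = ∫ x, B (f x) (h x) ∂ν) ?_ ?_ ?_ ?_ hf
  · intro c s hs hc
    have : IsFiniteMeasure ((ν.withDensityᵥ h).variation.restrict s) := ⟨by simpa using hc⟩
    rw [VectorMeasure.integral_indicator_const c hs, withDensityᵥ_apply hh hs,
      ← (B c).integral_comp_comm hh.integrableOn, ← integral_indicator hs]
    congr 1 with x
    by_cases hx : x ∈ s <;> simp [hx]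
  · intro f g _ hfi hgi hf hg
    simp only [Pi.add_apply, map_add, add_apply]
    rw [VectorMeasure.integral_fun_add hfi hgi, hf, hg, integral_add (hint hfi) (hint hgi)]
  · refine isClosed_eq VectorMeasure.continuous_integral ?_
    rw [hvar]
    exact continuous_integral_apply B hh.1
  · intro f g hfg _ hf
    rw [← VectorMeasure.integral_congr_ae hfg, hf]
    rw [hvar, EventuallyEq, ae_withDensity_iff' hh.1.enorm] at hfg
    refine integral_congr_ae ?_
    filter_upwards [hfg] with x hx
    by_cases h0 : h x = 0
    · simp [h0]
    · rw [hx (enorm_ne_zero.2 h0)]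

end DensityVectorMeasure

section ComplexMeasure

variable {X : Type*} {mX : MeasurableSpace X}

theorem absolutelyContinuous_toENNRealVectorMeasure {V : Type*} [NormedAddCommGroup V]
    {μ : VectorMeasure X V} {ν : Measure X} (hμν : μ.variation ≪ ν) :
    μ ≪ᵥ ν.toENNRealVectorMeasure := by
  refine VectorMeasure.AbsolutelyContinuous.mk fun s hs hνs => ?_
  rw [Measure.toENNRealVectorMeasure_apply_measurable hs] at hνs
  exact enorm_eq_zero.1 (nonpos_iff_eq_zero.1
    ((μ.enorm_measure_le_variation s).trans_eq (hμν hνs)))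

theorem withDensityᵥ_rnDeriv {μ : ComplexMeasure X} {ν : Measure X} [SigmaFinite ν]
    (hμν : μ ≪ᵥ ν.toENNRealVectorMeasure) : ν.withDensityᵥ (μ.rnDeriv ν) = μ := by
  obtain ⟨hre, him⟩ := (μ.absolutelyContinuous_ennreal_iff _).1 hμν
  have hint := μ.integrable_rnDeriv ν
  ext s hs
  rw [withDensityᵥ_apply hint hs]
  apply Complex.ext
  · calc (∫ x in s, μ.rnDeriv ν x ∂ν).re = ∫ x in s, μ.re.rnDeriv ν x ∂ν :=
        (integral_re hint.integrableOn).symm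
      _ = μ.re s := by
        rw [← withDensityᵥ_apply (SignedMeasure.integrable_rnDeriv _ _) hs,
          SignedMeasure.withDensityᵥ_rnDeriv_eq _ _ hre]
  · calc (∫ x in s, μ.rnDeriv ν x ∂ν).im = ∫ x in s, μ.im.rnDeriv ν x ∂ν :=
        (integral_im hint.integrableOn).symm
      _ = μ.im s := by
        rw [← withDensityᵥ_apply (SignedMeasure.integrable_rnDeriv _ _) hs,
          SignedMeasure.withDensityᵥ_rnDeriv_eq _ _ him]

theorem variation_le_totalVariation_re_add_im (μ : ComplexMeasure X) :
    μ.variation ≤ (ComplexMeasure.re μ).totalVariation + (ComplexMeasure.im μ).totalVariation := by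
  refine VectorMeasure.variation_le_of_forall_enorm_le fun s _ => ?_
  calc ‖μ s‖ₑ = ‖(μ.re s : ℂ) + μ.im s * Complex.I‖ₑ := by
        rw [ComplexMeasure.re_apply, ComplexMeasure.im_apply]
        exact congrArg _ (Complex.re_add_im (μ s)).symm
    _ ≤ ‖μ.re s‖ₑ + ‖μ.im s‖ₑ := by
        refine (enorm_add_le _ _).trans_eq ?_
        simp [enorm_eq_nnnorm]
    _ ≤ _ := by
        rw [Measure.add_apply]
        exact add_le_add (μ.re.enorm_le_totalVariation s) (μ.im.enorm_le_totalVariation s)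

instance isFiniteMeasure_variation (μ : ComplexMeasure X) : IsFiniteMeasure μ.variation :=
  isFiniteMeasure_of_le _ (variation_le_totalVariation_re_add_im μ)

end ComplexMeasure

section Division

theorem integrable_of_indicator_ae_eq_rnDeriv_smul {X E : Type*} [MeasurableSpace X]
    [NormedAddCommGroup E] [NormedSpace ℝ E] {μ ν : Measure X} [SigmaFinite μ] [SigmaFinite ν]
    (hμν : μ ≪ ν) {s : Set X} (hs : MeasurableSet s) {f h : X → E} (hh : IntegrableOn h s ν)
    (hf : s.indicator h =ᵐ[ν] fun x => (μ.rnDeriv ν x).toReal • f x) : Integrable f μ :=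
  (integrable_rnDeriv_smul_iff hμν).1 ((hh.integrable_indicator hs).congr hf)

theorem integral_smul_eq_setIntegral_of_indicator_ae_eq_rnDeriv_smul {X E 𝕜 : Type*}
    [MeasurableSpace X] [NormedAddCommGroup E] [NormedSpace ℝ E] [NormedRing 𝕜] [Module 𝕜 E]
    [SMulCommClass ℝ 𝕜 E] {μ ν : Measure X} [SigmaFinite μ] [SigmaFinite ν]
    (hμν : μ ≪ ν) {s : Set X} (hs : MeasurableSet s) {f h : X → E}
    (hf : s.indicator h =ᵐ[ν] fun x => (μ.rnDeriv ν x).toReal • f x) (φ : X → 𝕜) :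
    ∫ x, φ x • f x ∂μ = ∫ x in s, φ x • h x ∂ν := by
  rw [← integral_rnDeriv_smul hμν, ← integral_indicator hs]
  refine integral_congr_ae ?_
  filter_upwards [hf] with x hx
  rw [smul_comm, ← hx, Set.indicator_smul_apply]

variable {T : ℝ} [Fact (0 < T)] {E : Type*} [NormedAddCommGroup E] [NormedSpace ℂ E]
  {μ ν : Measure (AddCircle T)}

theorem ae_eq_rnDeriv_smul_of_forall_integral_fourier_smul_eq [CompleteSpace E] [SigmaFinite μ]
    [SigmaFinite ν] (hμν : μ ≪ ν) {g H : AddCircle T → E} (hg : Integrable g μ)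
    (hH : Integrable H ν)
    (h : ∀ k : ℤ, ∫ t, fourier k t • H t ∂ν = ∫ t, fourier k t • g t ∂μ) :
    H =ᵐ[ν] fun t => (μ.rnDeriv ν t).toReal • g t := by
  have hpg : Integrable (fun t => (μ.rnDeriv ν t).toReal • g t) ν :=
    (integrable_rnDeriv_smul_iff hμν).2 hg
  have hsub := ae_eq_zero_of_forall_integral_fourier_smul_eq_zero (hH.sub hpg) fun k => by
    simp only [Pi.sub_apply, smul_sub]
    rw [integral_sub (integrable_continuousMap_smul hH _) (integrable_continuousMap_smul hpg _),
      h k, ← integral_rnDeriv_smul hμν, sub_eq_zero]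
    exact integral_congr_ae (Eventually.of_forall fun t => smul_comm _ _ _)
  exact hsub.mono fun t ht => sub_eq_zero.1 ht

theorem integral_fourier_smul_one_sub_fourier_smul {h : AddCircle T → E} (hh : Integrable h ν)
    (m n : ℤ) : ∫ t, fourier m t • (1 - fourier n t) • h t ∂ν =
      ∫ t, fourier m t • h t ∂ν - ∫ t, fourier (m + n) t • h t ∂ν := by
  rw [← integral_sub (integrable_continuousMap_smul hh _) (integrable_continuousMap_smul hh _)]
  simp only [fourier_add, sub_smul, smul_sub, one_smul, mul_smul]

theorem exists_integrable_fourierCoeff_eq_setIntegral_compl_zero [SigmaFinite ν]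
    (hν : haarAddCircle ≪ ν) {h : AddCircle T → ℂ} (hh : Integrable h ν)
    (hsum : Summable fun k : ℤ =>
      ∫ t, fourier (-k) t • h t ∂ν - ∫ t, fourier (-(k + 1)) t • h t ∂ν) :
    ∃ f : AddCircle T → ℂ, Integrable f haarAddCircle ∧
      ∀ k : ℤ, fourierCoeff f k = ∫ t in {0}ᶜ, fourier (-k) t • h t ∂ν := by
  have hzero : MeasurableSet ({0}ᶜ : Set (AddCircle T)) := (measurableSet_singleton 0).compl
  let g : C(AddCircle T, ℂ) := ∑' k : ℤ,
    (∫ t, fourier (-k) t • h t ∂ν - ∫ t, fourier (-(k + 1)) t • h t ∂ν) • fourier k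
  have hgh : (fun t => (1 - fourier (-1) t) • h t) =ᵐ[ν]
      fun t => (haarAddCircle.rnDeriv ν t).toReal • g t := by
    refine ae_eq_rnDeriv_smul_of_forall_integral_fourier_smul_eq hν
      ((map_continuous g).integrable_of_hasCompactSupport (HasCompactSupport.of_compactSpace _))
      (integrable_continuousMap_smul hh (1 - fourier (-1))) fun k => ?_
    have hgk := fourierCoeff_tsum_smul_fourier (T := T) hsum (-k)
    rw [neg_neg, show -(-k + 1) = k + -1 by ring,
      ← integral_fourier_smul_one_sub_fourier_smul hh, fourierCoeff, neg_neg] at hgk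
    exact hgk.symm
  have hf : ({0}ᶜ : Set (AddCircle T)).indicator h =ᵐ[ν] fun t =>
      (haarAddCircle.rnDeriv ν t).toReal • (1 - fourier (-1) t)⁻¹ • g t := by
    filter_upwards [hgh] with t ht
    rw [smul_comm, ← ht]
    by_cases h0 : t = 0
    · simp [h0]
    · have hne : (1 : ℂ) - fourier (-1) t ≠ 0 := by
        rwa [sub_ne_zero, ne_comm, Ne, fourier_eq_one_iff, neg_one_zsmul, neg_eq_zero]
      rw [Set.indicator_of_mem (by simpa using h0), inv_smul_smul₀ hne]
  exact ⟨_, integrable_of_indicator_ae_eq_rnDeriv_smul hν hzero hh.integrableOn hf, fun k =>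
    integral_smul_eq_setIntegral_of_indicator_ae_eq_rnDeriv_smul hν hzero hf (fourier (-k))⟩

end Division

section MeasureCoefficients

variable {T : ℝ} [Fact (0 < T)]

/-- The `k`-th Fourier coefficient `∫ e^{-2πikt/T} dμ(t)` of a complex measure on the circle of
length `T`. It carries no factor `1 / T`, so that `f • haarAddCircle` has the coefficients
`fourierCoeff f`. -/
noncomputable def measureFourierCoeff (μ : ComplexMeasure (AddCircle T)) (k : ℤ) : ℂ :=
  ∫ᵛ t, fourier (-k) t ∂[ContinuousLinearMap.mul ℝ ℂ; μ]

theorem fourierStieltjesCoeff_eq_measureFourierCoeff (μ : ComplexMeasure Circle2Pi) :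
    fourierStieltjesCoeff μ = measureFourierCoeff ((1 / (2 * Real.pi)) • μ) := by
  ext k
  rw [fourierStieltjesCoeff, measureFourierCoeff, VectorMeasure.integral_smul_vectorMeasure,
    Complex.real_smul]
  push_cast
  rfl

theorem measureFourierCoeff_withDensityᵥ {ν : Measure (AddCircle T)} {h : AddCircle T → ℂ}
    (hh : Integrable h ν) (k : ℤ) :
    measureFourierCoeff (ν.withDensityᵥ h) k = ∫ t, fourier (-k) t • h t ∂ν :=
  integral_withDensityᵥ hh
    ((map_continuous (fourier (-k))).integrable_of_hasCompactSupport
      (HasCompactSupport.of_compactSpace _))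

theorem measureFourierCoeff_withDensityᵥ_sub_apply_zero {ν : Measure (AddCircle T)}
    {h : AddCircle T → ℂ} (hh : Integrable h ν) (k : ℤ) :
    measureFourierCoeff (ν.withDensityᵥ h) k - ν.withDensityᵥ h {0} =
      ∫ t in {0}ᶜ, fourier (-k) t • h t ∂ν := by
  have hzero : MeasurableSet ({0} : Set (AddCircle T)) := measurableSet_singleton 0
  have hatom : ν.withDensityᵥ h {0} = ∫ t in {0}, fourier (-k) t • h t ∂ν := by
    rw [withDensityᵥ_apply hh hzero]
    refine setIntegral_congr_fun hzero fun t ht => ?_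
    rw [Set.mem_singleton_iff.1 ht, fourier_eval_zero, one_smul]
  rw [measureFourierCoeff_withDensityᵥ hh, hatom, sub_eq_iff_eq_add',
    integral_add_compl hzero (integrable_continuousMap_smul hh (fourier (-k)))]

theorem exists_integrable_fourierCoeff_eq_measureFourierCoeff_sub
    {μ : ComplexMeasure (AddCircle T)} (hbv : IsBV (measureFourierCoeff μ)) :
    ∃ f : AddCircle T → ℂ, Integrable f haarAddCircle ∧
      ∀ k : ℤ, measureFourierCoeff μ k - μ {0} = fourierCoeff f k := by
  let ν : Measure (AddCircle T) := μ.variation + haarAddCircle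
  have hμν : μ.variation ≪ ν := (Measure.le_add_right le_rfl).absolutelyContinuous
  have hν : haarAddCircle ≪ ν := (Measure.le_add_left le_rfl).absolutelyContinuous
  have hdens : ν.withDensityᵥ (μ.rnDeriv ν) = μ :=
    withDensityᵥ_rnDeriv (absolutelyContinuous_toENNRealVectorMeasure hμν)
  have hint : Integrable (μ.rnDeriv ν) ν := μ.integrable_rnDeriv ν
  have hsum : Summable fun k : ℤ => ∫ t, fourier (-k) t • μ.rnDeriv ν t ∂ν -
      ∫ t, fourier (-(k + 1)) t • μ.rnDeriv ν t ∂ν := by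
    simpa only [← measureFourierCoeff_withDensityᵥ hint, hdens] using hbv.of_norm
  obtain ⟨f, hf, hfk⟩ := exists_integrable_fourierCoeff_eq_setIntegral_compl_zero hν hint hsum
  refine ⟨f, hf, fun k => ?_⟩
  rw [hfk, ← measureFourierCoeff_withDensityᵥ_sub_apply_zero hint, hdens]

end MeasureCoefficients

end TrigSeries

open TrigSeries in
theorem mainTheorem6_general {T : ℝ} [Fact (0 < T)] (μ : ComplexMeasure (AddCircle T))
    (hbv : IsBV (measureFourierCoeff μ)) :
    Tendsto (measureFourierCoeff μ) (atBot ⊔ atTop) (𝓝 (μ {0})) ∧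
      ∃ f : AddCircle T → ℂ, Integrable f haarAddCircle ∧
        ∀ k : ℤ, measureFourierCoeff μ k - μ {0} = fourierCoeff f k := by
  obtain ⟨f, hf, hfk⟩ := exists_integrable_fourierCoeff_eq_measureFourierCoeff_sub hbv
  refine ⟨?_, f, hf, hfk⟩
  rw [← Int.cofinite_eq, ← tendsto_sub_nhds_zero_iff]
  simpa only [hfk] using tendsto_fourierCoeff_cofinite f

theorem mainTheorem6 (c : ℤ → ℂ)
    (hFS : TrigSeries.IsFourierStieltjesSeries c)
    (hbv : TrigSeries.IsBV c)
    (hodd : Tendsto (fun k : ℤ => c k - c (-k)) atTop (𝓝 0)) :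
    ∃ L : ℂ, Tendsto c (atBot ⊔ atTop) (𝓝 L) ∧
      TrigSeries.IsFourierSeries (fun k : ℤ => c k - L) := by
  obtain ⟨μ, hμ⟩ := hFS
  obtain rfl := (funext hμ).trans (TrigSeries.fourierStieltjesCoeff_eq_measureFourierCoeff μ)
  exact ⟨_, mainTheorem6_general _ hbv⟩
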